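/- Let $d\ge 1$, let $[d]=\{1,\dots,d\}$, and let $c(y)=\sum_{1\le i<j\le d}c_{ij}\,y_iy_j$ for $y\in\mathbb R^d$, with $c_{ij}\ge 0$, be such that the graph on $[d]$ having an edge between $i<j$ if and only if $c_{ij}>0$ is connected. Let $\mu=(\mu_i)_{1\le i\le d}$ and $\nu=(\nu_i)_{1\le i\le d}$ be probability measures on $\mathbb R$ with finite second moments. Assume that $(\mu_i,\nu_i)_{1\le i\le d}$ satisfy LIM (linear increment of marginals) with $a=(a_1,\dots,a_d)$, i.e. $a_i>0$ for all $i$ and there is a non-Dirac probability measure $\kappa$ on $\mathbb R$ with finite first moment and $\int z\,\kappa(dz)=0$ such that, for every $i$, $$\nu_i=\mu_i * (a_i)_\#\kappa ,$$ where $(a_i)_\#\kappa$ is the push-forward of $\kappa$ by $z\mapsto a_iz$. Let $\Pi(\mu_1,\dots,\mu_d)$ be the set of probability measures on $\mathbb R^d$ with one-dimensional marginals $\mu_1,\dots,\mu_d$. Let $\mathcal M(\mu,\nu)$ be the set of laws $\pi$ on $\mathbb R^d\times\mathbb R^d$ of pairs $(X,Y)$ of random vectors with $X_i\sim\mu_i$,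 $Y_i\sim\nu_i$ for all $i$ and $\mathbb E[Y\mid X]=X$. An MMOT is a maximizer of $\pi\mapsto\int c(y)\,\pi(dx,dy)$ over $\mathcal M(\mu,\nu)$. For $\pi\in\mathcal M(\mu,\nu)$ let $\pi^1$ denote the law of $X$ under $\pi$, and let $L=\mathrm{span}(a)\subset\mathbb R^d$. Then every MMOT $\pi$, for every disintegration $\pi(dx,dy)=\pi_x(dy)\,\pi^1(dx)$ with probability kernels $\pi_x$, satisfies: 1. $\operatorname{supp}\pi_x\subset x+L$ for $\pi^1$-almost every $x$; 2. $\pi^1$ maximizes $\gamma\mapsto\int c(x)\,\gamma(dx)$ over $\Pi(\mu_1,\dots,\mu_d)$. Moreover, if $d=2$ or $d=3$ and the first marginals are atomless, i.e. $\mu_i(\{x\})=0$ for all $x\in\mathbb R$ and $i\in[d]$, then $\pi^1$ is the same for all MMOTs: if $\pi$ and $\tilde\pi$ are MMOTs, then $\pi^1=\tilde\pi^1$. -/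

import Mathlib

open MeasureTheory ProbabilityTheory

namespace CovMMOT

variable {d : ℕ}

/-- The covariance functional `c(y) = ∑_{i<j} c_ij y_i y_j`. Only the entries `c i j` with `i < j`
are used. -/
def cost (c : Fin d → Fin d → ℝ) (y : Fin d → ℝ) : ℝ :=
  ∑ i, ∑ j ∈ Finset.Ioi i, c i j * y i * y j

/-- The graph on `[d]` in which `i < j` are joined by an undirected edge iff `c_ij > 0`. -/
def costGraph (c : Fin d → Fin d → ℝ) : SimpleGraph (Fin d) :=
  SimpleGraph.fromRel fun i j => i < j ∧ 0 < c i j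

/-- Linear Increment of Marginals with scaling vector `a`: the `a_i` are positive and, for one
centered non-Dirac probability measure `κ` on `ℝ`, `ν_i = μ_i * (a_i)_# κ` for every `i`. -/
def LIM (μ ν : Fin d → Measure ℝ) (a : Fin d → ℝ) : Prop :=
  (∀ i, 0 < a i) ∧
    ∃ κ : Measure ℝ, IsProbabilityMeasure κ ∧ Integrable (fun z => z) κ ∧ ∫ z, z ∂κ = 0 ∧
      (∀ z, κ ≠ Measure.dirac z) ∧
      ∀ i, ν i = (μ i).conv (κ.map fun z => a i * z)

/-- `γ ∈ Π(μ_1, …, μ_d)`: a probability measure on `ℝ^d` with finite first moment and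
one-dimensional marginals `μ_i`. -/
structure IsTransport (μ : Fin d → Measure ℝ) (γ : Measure (Fin d → ℝ)) : Prop where
  prob : IsProbabilityMeasure γ
  integrable : Integrable (fun x => x) γ
  marginal : ∀ i, γ.map (fun x => x i) = μ i

/-- `γ` is an optimal transport plan for the maximization of `∫ c(x) γ(dx)` over
`Π(μ_1, …, μ_d)`. -/
def IsOptimalTransport (c : Fin d → Fin d → ℝ) (μ : Fin d → Measure ℝ)
    (γ : Measure (Fin d → ℝ)) : Prop :=
  IsTransport μ γ ∧ ∀ γ', IsTransport μ γ' → ∫ x, cost c x ∂γ' ≤ ∫ x, cost c x ∂γ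

/-- `π ∈ 𝓜(μ, ν)`: the law of a pair `(X, Y)` of integrable random vectors in `ℝ^d` with
`X_i ∼ μ_i`, `Y_i ∼ ν_i` for every `i` and `E[Y | X] = X`. -/
structure IsMartingaleTransport (μ ν : Fin d → Measure ℝ)
    (π : Measure ((Fin d → ℝ) × (Fin d → ℝ))) : Prop where
  prob : IsProbabilityMeasure π
  integrable : Integrable (fun p => p) π
  marginal_fst : ∀ i, π.map (fun p => p.1 i) = μ i
  marginal_snd : ∀ i, π.map (fun p => p.2 i) = ν i
  martingale : π[fun p => p.2 | MeasurableSpace.comap Prod.fst inferInstance] =ᵐ[π] fun p => p.1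

/-- `π` is an MMOT: a maximizer of `∫ c(y) π(dx, dy)` over `𝓜(μ, ν)`. -/
def IsMMOT (c : Fin d → Fin d → ℝ) (μ ν : Fin d → Measure ℝ)
    (π : Measure ((Fin d → ℝ) × (Fin d → ℝ))) : Prop :=
  IsMartingaleTransport μ ν π ∧
    ∀ π', IsMartingaleTransport μ ν π' → ∫ p, cost c p.2 ∂π' ≤ ∫ p, cost c p.2 ∂π

end CovMMOT

/-! Under a martingale transport `(X, Y)` the increment `Δ = Y - X` is orthogonal to `X`, so
`E cost Y = E cost X + E cost Δ`. Completing squares, `cost Δ = D Δ - energy Δ`, where `D` is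
diagonal, so that `E (D Δ)` depends on the marginals only, and `energy Δ ≥ 0` vanishes exactly on
`span a`, because the graph is connected. Under LIM every plan `γ` for the first marginals extends
to a martingale transport whose increments are independent noise along `a`, hence of zero energy.
Therefore the first marginal of an MMOT is optimal, and the energy of its increments vanishes.

For uniqueness, Hoeffding's formula bounds each `E (X_i X_j)` by its value at the comonotone
coupling, with equality only for almost surely comonotone `X_i` and `X_j`. Hence an optimal plan is
comonotone along the edges of the graph. Comonotonicity is transitive for atomless marginals, and
the law of a pairwise comonotone vector is determined by its marginals. -/

open Filter Topology

namespace CovMMOT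

section Energy

variable {d : ℕ} {c : Fin d → Fin d → ℝ} {a : Fin d → ℝ}

/-- The Dirichlet energy of `z / a` on the graph on `[d]` whose edge `i < j` carries the weight
`c_ij a_i a_j / 2`. -/
noncomputable def energy (c : Fin d → Fin d → ℝ) (a z : Fin d → ℝ) : ℝ :=
  ∑ i, ∑ j ∈ Finset.Ioi i, c i j * (a i * a j / 2) * (z i / a i - z j / a j) ^ 2

lemma measurable_cost (c : Fin d → Fin d → ℝ) : Measurable (cost c) := by
  unfold cost
  fun_prop

lemma measurable_energy (c : Fin d → Fin d → ℝ) (a : Fin d → ℝ) : Measurable (energy c a) := by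
  unfold energy
  fun_prop

lemma cost_add_energy (c : Fin d → Fin d → ℝ) (ha : ∀ i, a i ≠ 0) (z : Fin d → ℝ) :
    cost c z + energy c a z =
      ∑ i, ∑ j ∈ Finset.Ioi i, c i j / 2 * (a j / a i * z i ^ 2 + a i / a j * z j ^ 2) := by
  simp only [cost, energy, ← Finset.sum_add_distrib]
  refine Finset.sum_congr rfl fun i _ => Finset.sum_congr rfl fun j _ => ?_
  have hi := ha i
  have hj := ha j
  field_simp
  ring

lemma energy_smul_self (c : Fin d → Fin d → ℝ) (ha : ∀ i, a i ≠ 0) (t : ℝ) :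
    energy c a (t • a) = 0 := by
  simp [energy, ha]

lemma energy_term_nonneg (hc : ∀ i j, i < j → 0 ≤ c i j) (ha : ∀ i, 0 ≤ a i) (z : Fin d → ℝ)
    {i j : Fin d} (hij : i < j) : 0 ≤ c i j * (a i * a j / 2) * (z i / a i - z j / a j) ^ 2 := by
  have := hc i j hij
  have := ha i
  have := ha j
  positivity

lemma energy_nonneg (hc : ∀ i j, i < j → 0 ≤ c i j) (ha : ∀ i, 0 ≤ a i) (z : Fin d → ℝ) :
    0 ≤ energy c a z :=
  Finset.sum_nonneg fun _ _ => Finset.sum_nonneg fun _ hj =>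
    energy_term_nonneg hc ha z (Finset.mem_Ioi.1 hj)

lemma rel_of_costGraph_connected (hconn : (costGraph c).Connected) {R : Fin d → Fin d → Prop}
    (hR : Equivalence R) (hedge : ∀ i j, i < j → 0 < c i j → R i j) (i j : Fin d) : R i j := by
  have hadj : ∀ k l, (costGraph c).Adj k l → R k l := by
    rintro k l ⟨-, h | h⟩
    · exact hedge k l h.1 h.2
    · exact hR.symm (hedge l k h.1 h.2)
  induction (SimpleGraph.reachable_iff_reflTransGen i j).1 (hconn.preconnected i j) with
  | refl => exact hR.refl i
  | tail _ h ih => exact hR.trans ih (hadj _ _ h)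

lemma mem_span_of_energy_eq_zero (hc : ∀ i j, i < j → 0 ≤ c i j) (ha : ∀ i, 0 < a i)
    (hconn : (costGraph c).Connected) {z : Fin d → ℝ} (hz : energy c a z = 0) :
    z ∈ Submodule.span ℝ {a} := by
  have hterm : ∀ i, ∀ j ∈ Finset.Ioi i,
      0 ≤ c i j * (a i * a j / 2) * (z i / a i - z j / a j) ^ 2 := fun _ _ hj =>
    energy_term_nonneg hc (fun i => (ha i).le) z (Finset.mem_Ioi.1 hj)
  have hedge : ∀ i j, i < j → 0 < c i j → z i / a i = z j / a j := fun i j hij hcij => by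
    have hrow := (Finset.sum_eq_zero_iff_of_nonneg fun i _ => Finset.sum_nonneg (hterm i)).1 hz i
      (Finset.mem_univ i)
    have hij0 := (Finset.sum_eq_zero_iff_of_nonneg (hterm i)).1 hrow j (Finset.mem_Ioi.2 hij)
    have hweight : c i j * (a i * a j / 2) ≠ 0 :=
      (mul_pos hcij (half_pos (mul_pos (ha i) (ha j)))).ne'
    exact sub_eq_zero.1 (pow_eq_zero_iff two_ne_zero |>.1 <|
      (mul_eq_zero.1 hij0).resolve_left hweight)
  obtain ⟨i⟩ := hconn.nonempty
  have hconst : ∀ j, z i / a i = z j / a j := rel_of_costGraph_connected hconn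
    (R := fun i j => z i / a i = z j / a j) (eq_equivalence.comap fun i => z i / a i) hedge i
  refine Submodule.mem_span_singleton.2 ⟨z i / a i, funext fun j => ?_⟩
  rw [hconst j, Pi.smul_apply, smul_eq_mul, div_mul_cancel₀ _ (ha j).ne']

end Energy

section Pythagoras

variable {Ω : Type*} {m m₀ : MeasurableSpace Ω} {P : Measure Ω} [IsFiniteMeasure P]
  {X X' Y Y' : Ω → ℝ}

lemma integral_condExp_mul (hm : m ≤ m₀) (hY : MemLp Y 2 P) (hY' : MemLp Y' 2 P) :
    ∫ ω, (P[Y | m]) ω * Y' ω ∂P = ∫ ω, (P[Y | m]) ω * (P[Y' | m]) ω ∂P := by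
  have hpull : P[P[Y | m] * Y' | m] =ᵐ[P] P[Y | m] * P[Y' | m] :=
    condExp_mul_of_stronglyMeasurable_left stronglyMeasurable_condExp
      ((hY.condExp one_le_two).integrable_mul hY') (hY'.integrable one_le_two)
  exact (integral_condExp hm).symm.trans (integral_congr_ae hpull)

lemma integral_mul_eq_add_of_condExp_eq (hm : m ≤ m₀) (hY : MemLp Y 2 P) (hY' : MemLp Y' 2 P)
    (hX : P[Y | m] =ᵐ[P] X) (hX' : P[Y' | m] =ᵐ[P] X') :
    ∫ ω, Y ω * Y' ω ∂P =
      ∫ ω, X ω * X' ω ∂P + ∫ ω, (Y ω - X ω) * (Y' ω - X' ω) ∂P := by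
  have hX2 : MemLp X 2 P := (memLp_congr_ae hX).1 (hY.condExp one_le_two)
  have hX2' : MemLp X' 2 P := (memLp_congr_ae hX').1 (hY'.condExp one_le_two)
  have hXY' : ∫ ω, X ω * Y' ω ∂P = ∫ ω, X ω * X' ω ∂P :=
    (integral_congr_ae (hX.mul .rfl)).symm.trans <|
      (integral_condExp_mul hm hY hY').trans (integral_congr_ae (hX.mul hX'))
  have hYX' : ∫ ω, Y ω * X' ω ∂P = ∫ ω, X ω * X' ω ∂P := by
    simp only [mul_comm _ (X' _)]
    exact (integral_congr_ae (hX'.mul .rfl)).symm.trans <|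
      (integral_condExp_mul hm hY' hY).trans (integral_congr_ae (hX'.mul hX))
  have hYY : Integrable (fun ω => Y ω * Y' ω) P := hY.integrable_mul hY'
  have hXY : Integrable (fun ω => X ω * Y' ω) P := hX2.integrable_mul hY'
  have hYX : Integrable (fun ω => Y ω * X' ω) P := hY.integrable_mul hX2'
  have hXX : Integrable (fun ω => X ω * X' ω) P := hX2.integrable_mul hX2'
  have hexpand : ∀ ω, (Y ω - X ω) * (Y' ω - X' ω) =
      Y ω * Y' ω - X ω * Y' ω - (Y ω * X' ω - X ω * X' ω) := fun ω => by ring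
  simp only [hexpand]
  rw [integral_sub (by fun_prop) (by fun_prop), integral_sub hYY hXY, integral_sub hYX hXX, hXY',
    hYX']
  ring

end Pythagoras

section AddNoise

variable {E : Type*} [MeasurableSpace E]

/-- The law of `(X, X + W)` where `X ∼ γ` and `W ∼ ρ` are independent. -/
noncomputable def addNoise [Add E] (γ ρ : Measure E) : Measure (E × E) :=
  (γ.prod ρ).map fun q => (q.1, q.1 + q.2)

lemma fst_addNoise [Add E] [MeasurableAdd₂ E] (γ ρ : Measure E) [IsProbabilityMeasure ρ] :
    (addNoise γ ρ).fst = γ := by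
  rw [Measure.fst, addNoise, Measure.map_map measurable_fst (by fun_prop)]
  exact Measure.fst_prod

lemma snd_addNoise [AddMonoid E] [MeasurableAdd₂ E] (γ ρ : Measure E) :
    (addNoise γ ρ).snd = γ.conv ρ :=
  Measure.map_map measurable_snd (by fun_prop)

variable [NormedAddCommGroup E] [SecondCountableTopology E] [BorelSpace E] {γ ρ : Measure E}

lemma integrable_addNoise [IsProbabilityMeasure γ] [IsProbabilityMeasure ρ]
    (hγ : Integrable (fun x => x) γ) (hρ : Integrable (fun w => w) ρ) :
    Integrable (fun p => p) (addNoise γ ρ) :=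
  (integrable_map_measure (by fun_prop) (by fun_prop)).2 <|
    (hγ.comp_fst ρ).prodMk ((hγ.comp_fst ρ).add (hρ.comp_snd γ))

lemma condExp_snd_addNoise [NormedSpace ℝ E] [CompleteSpace E] [IsProbabilityMeasure γ]
    [IsProbabilityMeasure ρ] (hγ : Integrable (fun x => x) γ) (hρ : Integrable (fun w => w) ρ)
    (hρ0 : ∫ w, w ∂ρ = 0) :
    (addNoise γ ρ)[Prod.snd | MeasurableSpace.comap Prod.fst inferInstance]
      =ᵐ[addNoise γ ρ] Prod.fst := by
  have hint := integrable_addNoise hγ hρ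
  have : IsProbabilityMeasure (addNoise γ ρ) := Measure.isProbabilityMeasure_map (by fun_prop)
  refine (ae_eq_condExp_of_forall_setIntegral_eq measurable_fst.comap_le hint.snd
    (fun _ _ _ => hint.fst.integrableOn) ?_
    (comap_measurable _).stronglyMeasurable.aestronglyMeasurable).symm
  rintro _ ⟨t, ht, rfl⟩ -
  have hpre : (fun q : E × E => (q.1, q.1 + q.2)) ⁻¹' (Prod.fst ⁻¹' t) = t ×ˢ Set.univ := by
    ext
    simp
  have hnoise : ∫ q in t ×ˢ Set.univ, q.2 ∂γ.prod ρ = 0 := by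
    rw [← Measure.prod_restrict, Measure.restrict_univ, integral_fun_snd (fun w => w), hρ0,
      smul_zero]
  rw [addNoise, setIntegral_map (measurable_fst ht) (by fun_prop) (by fun_prop),
    setIntegral_map (measurable_fst ht) (by fun_prop) (by fun_prop), hpre,
    integral_add (hγ.comp_fst ρ).integrableOn (hρ.comp_snd γ).integrableOn, hnoise, add_zero]

end AddNoise

lemma memLp_of_hasLaw {Ω : Type*} [MeasurableSpace Ω] {P : Measure Ω} {X : Ω → ℝ} {μ : Measure ℝ}
    (h : HasLaw X μ P) {p : ENNReal} (hμ : MemLp (fun x => x) p μ) : MemLp X p P :=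
  (h.map_eq.symm ▸ hμ).comp_of_map h.aemeasurable

section MartingaleTransport

variable {d : ℕ} {c : Fin d → Fin d → ℝ} {μ ν : Fin d → Measure ℝ} {a : Fin d → ℝ}
  {γ : Measure (Fin d → ℝ)} {π : Measure ((Fin d → ℝ) × (Fin d → ℝ))}

lemma IsTransport.hasLaw (h : IsTransport μ γ) (i : Fin d) : HasLaw (fun x => x i) (μ i) γ :=
  ⟨(measurable_pi_apply i).aemeasurable, h.marginal i⟩

lemma IsMartingaleTransport.hasLaw_fst (h : IsMartingaleTransport μ ν π) (i : Fin d) :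
    HasLaw (fun p => p.1 i) (μ i) π :=
  ⟨by fun_prop, h.marginal_fst i⟩

lemma IsMartingaleTransport.hasLaw_snd (h : IsMartingaleTransport μ ν π) (i : Fin d) :
    HasLaw (fun p => p.2 i) (ν i) π :=
  ⟨by fun_prop, h.marginal_snd i⟩

lemma IsMartingaleTransport.isTransport_fst (h : IsMartingaleTransport μ ν π) :
    IsTransport μ π.fst where
  prob := have := h.prob; inferInstance
  integrable := (integrable_map_measure (by fun_prop) (by fun_prop)).2 h.integrable.fst
  marginal i := (Measure.map_map (by fun_prop) (by fun_prop)).trans (h.marginal_fst i)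

lemma isMartingaleTransport_addNoise (hγ : IsTransport μ γ) {κ : Measure ℝ}
    [IsProbabilityMeasure κ] (hκ : Integrable (fun z => z) κ) (hκ0 : ∫ z, z ∂κ = 0)
    (hν : ∀ i, ν i = (μ i).conv (κ.map fun z => a i * z)) :
    IsMartingaleTransport μ ν (addNoise γ (κ.map fun z => z • a)) := by
  have := hγ.prob
  have : IsProbabilityMeasure (κ.map fun z => z • a) :=
    Measure.isProbabilityMeasure_map (by fun_prop)
  have hρ : Integrable (fun w => w) (κ.map fun z => z • a) :=
    (integrable_map_measure (by fun_prop) (by fun_prop)).2 (hκ.smul_const a)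
  have hρ0 : ∫ w, w ∂κ.map (fun z => z • a) = 0 := by
    rw [integral_map (by fun_prop) (by fun_prop), integral_smul_const, hκ0, zero_smul]
  refine ⟨Measure.isProbabilityMeasure_map (by fun_prop), integrable_addNoise hγ.integrable hρ,
    fun i => ?_, fun i => ?_, condExp_snd_addNoise hγ.integrable hρ hρ0⟩
  · have hfst := congrArg (Measure.map fun x => x i) (fst_addNoise γ (κ.map fun z => z • a))
    rw [Measure.fst, Measure.map_map (by fun_prop) (by fun_prop), hγ.marginal i] at hfst
    exact hfst
  · have hconv := Measure.map_conv_continuousLinearMap (μ := γ) (ν := κ.map fun z => z • a)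
      (ContinuousLinearMap.proj (R := ℝ) (φ := fun _ : Fin d => ℝ) i)
    rw [← snd_addNoise, Measure.snd, Measure.map_map (by fun_prop) (by fun_prop),
      Measure.map_map (by fun_prop) (by fun_prop)] at hconv
    simp only [hν i, ← hγ.marginal i, mul_comm (a i)]
    exact hconv

lemma IsMartingaleTransport.condExp_snd_apply (h : IsMartingaleTransport μ ν π) (i : Fin d) :
    π[fun p => p.2 i | MeasurableSpace.comap Prod.fst inferInstance] =ᵐ[π] fun p => p.1 i := by
  have hcoord := (ContinuousLinearMap.proj (R := ℝ) (φ := fun _ : Fin d => ℝ) i).comp_condExp_comm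
    (m := MeasurableSpace.comap Prod.fst inferInstance) h.integrable.snd
  filter_upwards [hcoord, h.martingale] with p hp hmart
  exact hp.symm.trans (congrFun hmart i)

lemma IsMartingaleTransport.integral_snd_mul_snd (h : IsMartingaleTransport μ ν π)
    (hν : ∀ i, MemLp (fun y : ℝ => y) 2 (ν i)) (i j : Fin d) :
    ∫ p, p.2 i * p.2 j ∂π =
      ∫ p, p.1 i * p.1 j ∂π + ∫ p, (p.2 - p.1) i * (p.2 - p.1) j ∂π := by
  have := h.prob
  exact integral_mul_eq_add_of_condExp_eq measurable_fst.comap_le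
    (memLp_of_hasLaw (h.hasLaw_snd i) (hν i)) (memLp_of_hasLaw (h.hasLaw_snd j) (hν j))
    (h.condExp_snd_apply i) (h.condExp_snd_apply j)

lemma IsMartingaleTransport.memLp_sub (h : IsMartingaleTransport μ ν π)
    (hμ : ∀ i, MemLp (fun x : ℝ => x) 2 (μ i)) (hν : ∀ i, MemLp (fun y : ℝ => y) 2 (ν i))
    (i : Fin d) : MemLp (fun p => (p.2 - p.1) i) 2 π :=
  (memLp_of_hasLaw (h.hasLaw_snd i) (hν i)).sub (memLp_of_hasLaw (h.hasLaw_fst i) (hμ i))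

lemma IsMartingaleTransport.integral_sq_sub (h : IsMartingaleTransport μ ν π)
    (hν : ∀ i, MemLp (fun y : ℝ => y) 2 (ν i)) (i : Fin d) :
    ∫ p, (p.2 - p.1) i ^ 2 ∂π = ∫ y, y ^ 2 ∂ν i - ∫ x, x ^ 2 ∂μ i := by
  have hsq := h.integral_snd_mul_snd hν i i
  simp only [← sq] at hsq
  have hX := (h.hasLaw_fst i).integral_comp (f := fun x => x ^ 2) (by fun_prop)
  have hY := (h.hasLaw_snd i).integral_comp (f := fun y => y ^ 2) (by fun_prop)
  simp only [Function.comp_def] at hX hY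
  linarith

lemma integral_sum_Ioi {Ω : Type*} [MeasurableSpace Ω] {P : Measure Ω}
    {f : Fin d → Fin d → Ω → ℝ} (hf : ∀ i j, Integrable (f i j) P) :
    ∫ ω, ∑ i, ∑ j ∈ Finset.Ioi i, f i j ω ∂P = ∑ i, ∑ j ∈ Finset.Ioi i, ∫ ω, f i j ω ∂P := by
  rw [integral_finsetSum _ fun i _ => integrable_finsetSum _ fun j _ => hf i j]
  exact Finset.sum_congr rfl fun i _ => integral_finsetSum _ fun j _ => hf i j

variable {Ω : Type*} [MeasurableSpace Ω] {P : Measure Ω} {X : Ω → Fin d → ℝ}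

lemma integrable_cost (c : Fin d → Fin d → ℝ) (hX : ∀ i, MemLp (fun ω => X ω i) 2 P) :
    Integrable (fun ω => cost c (X ω)) P :=
  integrable_finsetSum _ fun i _ => integrable_finsetSum _ fun j _ => by
    simpa only [mul_assoc, Pi.mul_apply] using ((hX i).integrable_mul (hX j)).const_mul (c i j)

lemma integrable_energy (c : Fin d → Fin d → ℝ) (a : Fin d → ℝ)
    (hX : ∀ i, MemLp (fun ω => X ω i) 2 P) : Integrable (fun ω => energy c a (X ω)) P :=
  integrable_finsetSum _ fun i _ => integrable_finsetSum _ fun j _ =>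
    (((hX i).mul_const (a i)⁻¹).sub ((hX j).mul_const (a j)⁻¹)).integrable_sq.const_mul _

lemma integral_cost (c : Fin d → Fin d → ℝ) (hX : ∀ i, MemLp (fun ω => X ω i) 2 P) :
    ∫ ω, cost c (X ω) ∂P = ∑ i, ∑ j ∈ Finset.Ioi i, c i j * ∫ ω, X ω i * X ω j ∂P := by
  simp only [cost, mul_assoc]
  have hmul i j : Integrable (fun ω => c i j * (X ω i * X ω j)) P :=
    ((hX i).integrable_mul (hX j)).const_mul (c i j)
  simp only [integral_sum_Ioi hmul, integral_const_mul]

lemma integral_cost_add_energy (c : Fin d → Fin d → ℝ) (ha : ∀ i, a i ≠ 0)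
    (hX : ∀ i, MemLp (fun ω => X ω i) 2 P) :
    ∫ ω, cost c (X ω) ∂P + ∫ ω, energy c a (X ω) ∂P = ∑ i, ∑ j ∈ Finset.Ioi i, c i j / 2 *
      (a j / a i * ∫ ω, X ω i ^ 2 ∂P + a i / a j * ∫ ω, X ω j ^ 2 ∂P) := by
  have hsq (r : ℝ) i : Integrable (fun ω => r * X ω i ^ 2) P := (hX i).integrable_sq.const_mul r
  have hdiag i j : Integrable
      (fun ω => c i j / 2 * (a j / a i * X ω i ^ 2 + a i / a j * X ω j ^ 2)) P :=
    ((hsq _ i).add (hsq _ j)).const_mul _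
  rw [← integral_add (integrable_cost c hX) (integrable_energy c a hX)]
  simp only [cost_add_energy c ha, integral_sum_Ioi hdiag, integral_const_mul,
    integral_add (hsq _ _) (hsq _ _)]

lemma IsMartingaleTransport.integral_cost_snd (h : IsMartingaleTransport μ ν π)
    (hμ : ∀ i, MemLp (fun x : ℝ => x) 2 (μ i)) (hν : ∀ i, MemLp (fun y : ℝ => y) 2 (ν i))
    (c : Fin d → Fin d → ℝ) :
    ∫ p, cost c p.2 ∂π = ∫ x, cost c x ∂π.fst + ∫ p, cost c (p.2 - p.1) ∂π := by
  have hfst : ∫ x, cost c x ∂π.fst = ∫ p, cost c p.1 ∂π :=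
    integral_map measurable_fst.aemeasurable (measurable_cost c).aestronglyMeasurable
  rw [hfst, integral_cost c fun i => memLp_of_hasLaw (h.hasLaw_fst i) (hμ i),
    integral_cost c fun i => memLp_of_hasLaw (h.hasLaw_snd i) (hν i),
    integral_cost c (h.memLp_sub hμ hν)]
  simp only [h.integral_snd_mul_snd hν, mul_add, Finset.sum_add_distrib]

/-- The expectation of `cost c Δ + energy c a Δ` for the increment `Δ = Y - X` of any martingale
transport `(X, Y)` between `μ` and `ν`. -/
noncomputable def incrementValue (c : Fin d → Fin d → ℝ) (a : Fin d → ℝ)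
    (μ ν : Fin d → Measure ℝ) : ℝ :=
  ∑ i, ∑ j ∈ Finset.Ioi i, c i j / 2 *
    (a j / a i * (∫ y, y ^ 2 ∂ν i - ∫ x, x ^ 2 ∂μ i) +
      a i / a j * (∫ y, y ^ 2 ∂ν j - ∫ x, x ^ 2 ∂μ j))

lemma IsMartingaleTransport.integral_cost_snd_add_energy (h : IsMartingaleTransport μ ν π)
    (hμ : ∀ i, MemLp (fun x : ℝ => x) 2 (μ i)) (hν : ∀ i, MemLp (fun y : ℝ => y) 2 (ν i))
    (c : Fin d → Fin d → ℝ) (ha : ∀ i, a i ≠ 0) :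
    ∫ p, cost c p.2 ∂π + ∫ p, energy c a (p.2 - p.1) ∂π =
      ∫ x, cost c x ∂π.fst + incrementValue c a μ ν := by
  rw [h.integral_cost_snd hμ hν, add_assoc, integral_cost_add_energy c ha (h.memLp_sub hμ hν)]
  simp only [h.integral_sq_sub hν, incrementValue]

end MartingaleTransport

section MMOT

variable {d : ℕ} {c : Fin d → Fin d → ℝ} {μ ν : Fin d → Measure ℝ} {a : Fin d → ℝ}
  {γ : Measure (Fin d → ℝ)} {π : Measure ((Fin d → ℝ) × (Fin d → ℝ))}

lemma integral_energy_addNoise_eq_zero (c : Fin d → Fin d → ℝ) (ha : ∀ i, a i ≠ 0)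
    (γ : Measure (Fin d → ℝ)) [SFinite γ] (κ : Measure ℝ) [SFinite κ] :
    ∫ p, energy c a (p.2 - p.1) ∂addNoise γ (κ.map fun z => z • a) = 0 := by
  have hmeas := measurable_energy c a
  have hsub : Measurable fun p : (Fin d → ℝ) × (Fin d → ℝ) => energy c a (p.2 - p.1) :=
    hmeas.comp (by fun_prop)
  rw [addNoise, integral_map (by fun_prop) hsub.aestronglyMeasurable]
  simp only [add_sub_cancel_left]
  rw [integral_fun_snd (energy c a), integral_map (by fun_prop) hmeas.aestronglyMeasurable]
  simp only [energy_smul_self c ha, integral_zero, smul_zero]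

lemma IsMMOT.integral_cost_add_energy_le (h : IsMMOT c μ ν π)
    (hμ : ∀ i, MemLp (fun x : ℝ => x) 2 (μ i)) (hν : ∀ i, MemLp (fun y : ℝ => y) 2 (ν i))
    (hLIM : LIM μ ν a) (hγ : IsTransport μ γ) :
    ∫ x, cost c x ∂γ + ∫ p, energy c a (p.2 - p.1) ∂π ≤ ∫ x, cost c x ∂π.fst := by
  obtain ⟨ha, κ, _, hκ, hκ0, -, hconv⟩ := hLIM
  have ha0 : ∀ i, a i ≠ 0 := fun i => (ha i).ne'
  have := hγ.prob
  have : IsProbabilityMeasure (κ.map fun z => z • a) :=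
    Measure.isProbabilityMeasure_map (by fun_prop)
  have hnoise := isMartingaleTransport_addNoise hγ hκ hκ0 hconv
  have hle := h.2 _ hnoise
  have hπ := h.1.integral_cost_snd_add_energy hμ hν c ha0
  have hγ' := hnoise.integral_cost_snd_add_energy hμ hν c ha0
  rw [fst_addNoise, integral_energy_addNoise_eq_zero c ha0, add_zero] at hγ'
  linarith

lemma IsMMOT.isOptimalTransport_fst (h : IsMMOT c μ ν π) (hc : ∀ i j, i < j → 0 ≤ c i j)
    (hμ : ∀ i, MemLp (fun x : ℝ => x) 2 (μ i)) (hν : ∀ i, MemLp (fun y : ℝ => y) 2 (ν i))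
    (hLIM : LIM μ ν a) : IsOptimalTransport c μ π.fst := by
  refine ⟨h.1.isTransport_fst, fun γ hγ => ?_⟩
  have henergy : 0 ≤ ∫ p, energy c a (p.2 - p.1) ∂π :=
    integral_nonneg fun p => energy_nonneg hc (fun i => (hLIM.1 i).le) _
  linarith [h.integral_cost_add_energy_le hμ hν hLIM hγ]

lemma IsMMOT.ae_sub_mem_span (h : IsMMOT c μ ν π) (hc : ∀ i j, i < j → 0 ≤ c i j)
    (hconn : (costGraph c).Connected)
    (hμ : ∀ i, MemLp (fun x : ℝ => x) 2 (μ i)) (hν : ∀ i, MemLp (fun y : ℝ => y) 2 (ν i))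
    (hLIM : LIM μ ν a) : ∀ᵐ p ∂π, p.2 - p.1 ∈ Submodule.span ℝ {a} := by
  have hnonneg : ∀ z, 0 ≤ energy c a z := energy_nonneg hc fun i => (hLIM.1 i).le
  have hint : Integrable (fun p => energy c a (p.2 - p.1)) π :=
    integrable_energy c a (h.1.memLp_sub hμ hν)
  have hzero : ∫ p, energy c a (p.2 - p.1) ∂π = 0 := le_antisymm
    (by linarith [h.integral_cost_add_energy_le hμ hν hLIM h.1.isTransport_fst])
    (integral_nonneg fun p => hnonneg _)
  filter_upwards [(integral_eq_zero_iff_of_nonneg (fun p => hnonneg _) hint).1 hzero] with p hp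
  exact mem_span_of_energy_eq_zero hc hLIM.1 hconn hp

lemma ae_support_subset_of_ae_compProd {α β : Type*} [MeasurableSpace α] [MeasurableSpace β]
    [TopologicalSpace β] {ρ : Measure α} [SFinite ρ]
    {K : Kernel α β} [IsSFiniteKernel K] {S : Set (α × β)} (hS : MeasurableSet S)
    (hclosed : ∀ x, IsClosed {y | (x, y) ∈ S}) (h : ∀ᵐ p ∂ρ.compProd K, p ∈ S) :
    ∀ᵐ x ∂ρ, (K x).support ⊆ {y | (x, y) ∈ S} := by
  filter_upwards [(Measure.ae_compProd_iff hS).1 h] with x hx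
  exact Measure.support_subset_of_isClosed (hclosed x) hx

lemma IsMMOT.support_subset (h : IsMMOT c μ ν π) (hc : ∀ i j, i < j → 0 ≤ c i j)
    (hconn : (costGraph c).Connected)
    (hμ : ∀ i, MemLp (fun x : ℝ => x) 2 (μ i)) (hν : ∀ i, MemLp (fun y : ℝ => y) 2 (ν i))
    (hLIM : LIM μ ν a) (K : Kernel (Fin d → ℝ) (Fin d → ℝ)) [IsMarkovKernel K]
    (hK : π = π.fst.compProd K) :
    ∀ᵐ x ∂π.fst, (K x).support ⊆ {y | y - x ∈ Submodule.span ℝ {a}} := by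
  have := h.1.prob
  have hL : IsClosed (Submodule.span ℝ {a} : Set (Fin d → ℝ)) :=
    Submodule.closed_of_finiteDimensional _
  exact ae_support_subset_of_ae_compProd
    (S := {p | p.2 - p.1 ∈ Submodule.span ℝ {a}})
    (hL.preimage (continuous_snd.sub continuous_fst)).measurableSet
    (fun x => hL.preimage (continuous_id.sub continuous_const))
    (hK ▸ h.ae_sub_mem_span hc hconn hμ hν hLIM)

end MMOT

section Comonotone

variable {Ω : Type*} [MeasurableSpace Ω] {P : Measure Ω}

/-- `X` and `Y` are almost surely comonotone: their superlevel sets are nested up to null sets. -/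
def AEComonotone {α β : Type*} [Preorder α] [Preorder β] (P : Measure Ω) (X : Ω → α)
    (Y : Ω → β) : Prop :=
  ∀ s t, X ⁻¹' Set.Ioi s ≤ᵐ[P] Y ⁻¹' Set.Ioi t ∨ Y ⁻¹' Set.Ioi t ≤ᵐ[P] X ⁻¹' Set.Ioi s

lemma AEComonotone.refl {α : Type*} [LinearOrder α] (X : Ω → α) : AEComonotone P X X :=
  fun s t => (le_total t s).imp
    (fun h => (Set.preimage_mono (Set.Ioi_subset_Ioi h)).eventuallyLE)
    fun h => (Set.preimage_mono (Set.Ioi_subset_Ioi h)).eventuallyLE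

lemma AEComonotone.symm {α β : Type*} [Preorder α] [Preorder β] {X : Ω → α} {Y : Ω → β}
    (h : AEComonotone P X Y) : AEComonotone P Y X :=
  fun s t => (h t s).symm

lemma continuous_cdf (μ : Measure ℝ) [IsProbabilityMeasure μ] [NullSingletonClass μ] :
    Continuous (cdf μ) := by
  refine continuous_iff_continuousAt.2 fun x => ?_
  rw [(monotone_cdf μ).continuousAt_iff_leftLim_eq_rightLim, StieltjesFunction.rightLim_eq]
  have hjump := (cdf μ).measure_singleton x
  rw [measure_cdf, measure_singleton, eq_comm, ENNReal.ofReal_eq_zero] at hjump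
  exact le_antisymm ((monotone_cdf μ).leftLim_le le_rfl) (sub_nonpos.1 hjump)

lemma measureReal_Ioi_eq_one_sub_cdf (μ : Measure ℝ) [IsProbabilityMeasure μ] (x : ℝ) :
    μ.real (Set.Ioi x) = 1 - cdf μ x := by
  rw [cdf_eq_real, ← probReal_compl_eq_one_sub measurableSet_Iic, Set.compl_Iic]

lemma exists_measureReal_Ioi_eq (μ : Measure ℝ) [IsProbabilityMeasure μ] [NullSingletonClass μ]
    {u : ℝ} (h0 : 0 < u) (h1 : u < 1) : ∃ r, μ.real (Set.Ioi r) = u := by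
  obtain ⟨x, hx⟩ := ((tendsto_cdf_atBot μ).eventually_lt_const (sub_pos.2 h1)).exists
  obtain ⟨y, hy⟩ := ((tendsto_cdf_atTop μ).eventually_const_lt (sub_lt_self 1 h0)).exists
  obtain ⟨r, hr⟩ :=
    mem_range_of_exists_le_of_exists_ge (continuous_cdf μ) ⟨x, hx.le⟩ ⟨y, hy.le⟩
  exact ⟨r, by rw [measureReal_Ioi_eq_one_sub_cdf, hr, sub_sub_cancel]⟩

variable {X Y Z : Ω → ℝ}

lemma AEComonotone.preimage_Ioi_ae_eq [IsProbabilityMeasure P] (h : AEComonotone P X Y)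
    (hX : AEMeasurable X P) (hY : AEMeasurable Y P) [NullSingletonClass (P.map Y)] (s : ℝ) :
    X ⁻¹' Set.Ioi s =ᵐ[P] (∅ : Set Ω) ∨ X ⁻¹' Set.Ioi s =ᵐ[P] (Set.univ : Set Ω) ∨
      ∃ r, X ⁻¹' Set.Ioi s =ᵐ[P] Y ⁻¹' Set.Ioi r := by
  have hXs : NullMeasurableSet (X ⁻¹' Set.Ioi s) P := hX.nullMeasurable measurableSet_Ioi
  rcases (measureReal_nonneg (μ := P) (s := X ⁻¹' Set.Ioi s)).eq_or_lt with h0 | h0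
  · exact .inl (ae_eq_empty.2 ((measureReal_eq_zero_iff).1 h0.symm))
  rcases (measureReal_le_one (μ := P) (s := X ⁻¹' Set.Ioi s)).eq_or_lt with h1 | h1
  · refine .inr (.inl (ae_eq_of_ae_subset_of_measure_ge (Set.subset_univ _).eventuallyLE ?_ hXs
      (measure_ne_top _ _)))
    rw [measure_univ, ← ofReal_measureReal, h1, ENNReal.ofReal_one]
  have := Measure.isProbabilityMeasure_map hY
  obtain ⟨r, hr⟩ := exists_measureReal_Ioi_eq (P.map Y) h0 h1
  rw [map_measureReal_apply_of_aemeasurable hY measurableSet_Ioi,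
    measureReal_eq_measureReal_iff] at hr
  refine .inr (.inr ⟨r, ?_⟩)
  rcases h s r with hle | hle
  · exact ae_eq_of_ae_subset_of_measure_ge hle hr.le hXs (measure_ne_top _ _)
  · exact (ae_eq_of_ae_subset_of_measure_ge hle hr.ge (hY.nullMeasurable measurableSet_Ioi)
      (measure_ne_top _ _)).symm

lemma AEComonotone.trans [IsProbabilityMeasure P] (hXY : AEComonotone P X Y)
    (hYZ : AEComonotone P Y Z) (hX : AEMeasurable X P) (hY : AEMeasurable Y P)
    [NullSingletonClass (P.map Y)] : AEComonotone P X Z := by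
  intro s t
  rcases hXY.preimage_Ioi_ae_eq hX hY s with h | h | ⟨r, h⟩
  · exact .inl (h.le.trans (Set.empty_subset _).eventuallyLE)
  · exact .inr ((Set.subset_univ _).eventuallyLE.trans h.symm.le)
  · exact (hYZ r t).imp h.le.trans fun hle => hle.trans h.symm.le

/-- The joint survival function of `X` and `Y`. -/
noncomputable def jointTail (P : Measure Ω) (X Y : Ω → ℝ) (s t : ℝ) : ℝ :=
  P.real (X ⁻¹' Set.Ioi s ∩ Y ⁻¹' Set.Ioi t)

lemma jointTail_comm (X Y : Ω → ℝ) (s t : ℝ) : jointTail P X Y s t = jointTail P Y X t s := by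
  rw [jointTail, jointTail, Set.inter_comm]

variable [IsFiniteMeasure P]

lemma jointTail_mono {s s' t t' : ℝ} (hs : s ≤ s') (ht : t ≤ t') :
    jointTail P X Y s' t' ≤ jointTail P X Y s t :=
  measureReal_mono (Set.inter_subset_inter (Set.preimage_mono (Set.Ioi_subset_Ioi hs))
    (Set.preimage_mono (Set.Ioi_subset_Ioi ht)))

lemma jointTail_le_min (s t : ℝ) :
    jointTail P X Y s t ≤ min (P.real (X ⁻¹' Set.Ioi s)) (P.real (Y ⁻¹' Set.Ioi t)) :=
  le_min (measureReal_mono Set.inter_subset_left) (measureReal_mono Set.inter_subset_right)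

lemma preimage_Ioi_ae_le_iff (hY : AEMeasurable Y P) (s t : ℝ) :
    X ⁻¹' Set.Ioi s ≤ᵐ[P] Y ⁻¹' Set.Ioi t ↔ P.real (X ⁻¹' Set.Ioi s) ≤ jointTail P X Y s t := by
  rw [ae_le_set, ← measureReal_eq_zero_iff, jointTail, ← measureReal_inter_add_sdiff₀
    (s := X ⁻¹' Set.Ioi s) (hY.nullMeasurable measurableSet_Ioi), add_le_iff_nonpos_right]
  exact ⟨le_of_eq, fun h => h.antisymm measureReal_nonneg⟩

lemma aeComonotone_iff_min_le_jointTail (hX : AEMeasurable X P) (hY : AEMeasurable Y P) :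
    AEComonotone P X Y ↔
      ∀ s t, min (P.real (X ⁻¹' Set.Ioi s)) (P.real (Y ⁻¹' Set.Ioi t)) ≤ jointTail P X Y s t := by
  refine forall₂_congr fun s t => ?_
  rw [min_le_iff, preimage_Ioi_ae_le_iff hY, preimage_Ioi_ae_le_iff hX, jointTail_comm Y X]

lemma AEComonotone.jointTail_eq_min (h : AEComonotone P X Y) (hX : AEMeasurable X P)
    (hY : AEMeasurable Y P) (s t : ℝ) :
    jointTail P X Y s t = min (P.real (X ⁻¹' Set.Ioi s)) (P.real (Y ⁻¹' Set.Ioi t)) :=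
  (jointTail_le_min s t).antisymm ((aeComonotone_iff_min_le_jointTail hX hY).1 h s t)

end Comonotone

section Hoeffding

variable {Ω : Type*} [MeasurableSpace Ω] {P : Measure Ω} {X Y : Ω → ℝ}

/-- The signed layer function `1_{s < x} - 1_{s < 0}`. It represents `x` as its integral in `s`,
which turns the expectation of a product into an integral of joint tails. -/
noncomputable def layer (s x : ℝ) : ℝ := (if s < x then 1 else 0) - if s < 0 then 1 else 0

lemma measurable_layer : Measurable fun q : ℝ × ℝ => layer q.1 q.2 := by
  unfold layer
  exact (measurable_const.ite (measurableSet_lt measurable_fst measurable_snd)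
    measurable_const).sub
      (measurable_const.ite (measurableSet_lt measurable_fst measurable_const) measurable_const)

lemma layer_eq_indicator_sub (s x : ℝ) :
    layer s x = (Set.Ico 0 x).indicator 1 s - (Set.Ico x 0).indicator 1 s := by
  simp only [layer, Set.indicator_apply, Set.mem_Ico, Pi.one_apply]
  grind

lemma norm_layer (s x : ℝ) :
    ‖layer s x‖ = (Set.Ico 0 x).indicator 1 s + (Set.Ico x 0).indicator 1 s := by
  simp only [layer, Set.indicator_apply, Set.mem_Ico, Pi.one_apply, Real.norm_eq_abs]
  grind

lemma integrable_indicator_Ico (x y : ℝ) : Integrable ((Set.Ico x y).indicator (1 : ℝ → ℝ)) :=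
  (integrable_indicator_iff measurableSet_Ico).2 (integrableOn_const (by simp))

lemma integrable_layer (x : ℝ) : Integrable (fun s => layer s x) := by
  simp only [layer_eq_indicator_sub]
  exact (integrable_indicator_Ico 0 x).sub (integrable_indicator_Ico x 0)

lemma integral_layer (x : ℝ) : ∫ s, layer s x = x := by
  simp only [layer_eq_indicator_sub]
  rw [integral_sub (integrable_indicator_Ico 0 x) (integrable_indicator_Ico x 0),
    integral_indicator_one measurableSet_Ico, integral_indicator_one measurableSet_Ico,
    Real.volume_real_Ico, Real.volume_real_Ico]
  grind

lemma integral_norm_layer (x : ℝ) : ∫ s, ‖layer s x‖ = ‖x‖ := by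
  simp only [norm_layer]
  rw [integral_add (integrable_indicator_Ico 0 x) (integrable_indicator_Ico x 0),
    integral_indicator_one measurableSet_Ico, integral_indicator_one measurableSet_Ico,
    Real.volume_real_Ico, Real.volume_real_Ico, Real.norm_eq_abs]
  grind

lemma integrable_layer_mul_layer (hX : AEMeasurable X P) (hY : AEMeasurable Y P)
    (hXY : Integrable (fun ω => X ω * Y ω) P) :
    Integrable (fun q : Ω × (ℝ × ℝ) => layer q.2.1 (X q.1) * layer q.2.2 (Y q.1))
      (P.prod volume) := by
  have hm : AEMeasurable (fun q : Ω × (ℝ × ℝ) => layer q.2.1 (X q.1) * layer q.2.2 (Y q.1))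
      (P.prod volume) :=
    (measurable_layer.comp_aemeasurable
      (f := fun q : Ω × (ℝ × ℝ) => (q.2.1, X q.1)) (by fun_prop)).mul
    (measurable_layer.comp_aemeasurable
      (f := fun q : Ω × (ℝ × ℝ) => (q.2.2, Y q.1)) (by fun_prop))
  refine (integrable_prod_iff hm.aestronglyMeasurable).2
    ⟨.of_forall fun ω => (integrable_layer (X ω)).mul_prod (integrable_layer (Y ω)), ?_⟩
  refine hXY.norm.congr (.of_forall fun ω => ?_)
  simp only [norm_mul]
  rw [Measure.volume_eq_prod, integral_prod_mul (fun s => ‖layer s (X ω)‖)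
    (fun t => ‖layer t (Y ω)‖), integral_norm_layer, integral_norm_layer]

lemma integral_mul_eq_integral_layer [SFinite P] (hX : AEMeasurable X P) (hY : AEMeasurable Y P)
    (hXY : Integrable (fun ω => X ω * Y ω) P) :
    ∫ ω, X ω * Y ω ∂P = ∫ q : ℝ × ℝ, ∫ ω, layer q.1 (X ω) * layer q.2 (Y ω) ∂P := by
  rw [← integral_integral_swap (f := fun ω (q : ℝ × ℝ) => layer q.1 (X ω) * layer q.2 (Y ω))
    (integrable_layer_mul_layer hX hY hXY)]
  refine integral_congr_ae (.of_forall fun ω => ?_)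
  simp only
  rw [Measure.volume_eq_prod, integral_prod_mul (fun s => layer s (X ω))
    (fun t => layer t (Y ω)), integral_layer, integral_layer]

lemma integral_layer_mul_layer [IsProbabilityMeasure P] (hX : AEMeasurable X P)
    (hY : AEMeasurable Y P) (s t : ℝ) :
    ∫ ω, layer s (X ω) * layer t (Y ω) ∂P =
      jointTail P X Y s t - (if t < 0 then 1 else 0) * P.real (X ⁻¹' Set.Ioi s) -
        (if s < 0 then 1 else 0) * P.real (Y ⁻¹' Set.Ioi t) +
        (if s < 0 then 1 else 0) * (if t < 0 then 1 else 0) := by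
  set A := X ⁻¹' Set.Ioi s
  set B := Y ⁻¹' Set.Ioi t
  have hA : NullMeasurableSet A P := hX.nullMeasurable measurableSet_Ioi
  have hB : NullMeasurableSet B P := hY.nullMeasurable measurableSet_Ioi
  have hexpand : ∀ ω, layer s (X ω) * layer t (Y ω) =
      (A ∩ B).indicator 1 ω - (if t < 0 then 1 else 0) * A.indicator 1 ω -
        (if s < 0 then 1 else 0) * B.indicator 1 ω +
        (if s < 0 then 1 else 0) * (if t < 0 then 1 else 0) := fun ω => by
    have hAω : A.indicator (1 : Ω → ℝ) ω = if s < X ω then 1 else 0 := by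
      simp [A, Set.indicator]
    have hBω : B.indicator (1 : Ω → ℝ) ω = if t < Y ω then 1 else 0 := by
      simp [B, Set.indicator]
    rw [Set.inter_indicator_one, Pi.mul_apply, hAω, hBω, layer, layer]
    ring
  have hintegrable : ∀ {S : Set Ω}, NullMeasurableSet S P →
      Integrable (S.indicator (1 : Ω → ℝ)) P := fun hS => (integrable_const 1).indicator₀ hS
  have hintegral : ∀ {S : Set Ω}, NullMeasurableSet S P →
      ∫ ω, S.indicator (1 : Ω → ℝ) ω ∂P = P.real S := fun hS => by
    rw [integral_indicator₀ hS]
    exact setIntegral_one_eq_measureReal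
  have := hintegrable hA
  have := hintegrable hB
  have := hintegrable (hA.inter hB)
  simp only [hexpand]
  rw [integral_add (by fun_prop) (by fun_prop), integral_sub (by fun_prop) (by fun_prop),
    integral_sub (by fun_prop) (by fun_prop), integral_const_mul, integral_const_mul,
    hintegral hA, hintegral hB, hintegral (hA.inter hB), integral_const, probReal_univ, one_smul,
    jointTail]

variable {Ω' : Type*} [MeasurableSpace Ω'] {P' : Measure Ω'} {X' Y' : Ω' → ℝ}

lemma measureReal_preimage_Ioi_eq (hX : IdentDistrib X X' P P') (s : ℝ) :
    P.real (X ⁻¹' Set.Ioi s) = P'.real (X' ⁻¹' Set.Ioi s) :=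
  congrArg ENNReal.toReal (hX.measure_mem_eq measurableSet_Ioi)

lemma AEComonotone.jointTail_le [IsFiniteMeasure P] [IsFiniteMeasure P']
    (h : AEComonotone P' X' Y') (hX : IdentDistrib X X' P P') (hY : IdentDistrib Y Y' P P')
    (s t : ℝ) : jointTail P X Y s t ≤ jointTail P' X' Y' s t := by
  rw [h.jointTail_eq_min hX.aemeasurable_snd hY.aemeasurable_snd,
    ← measureReal_preimage_Ioi_eq hX, ← measureReal_preimage_Ioi_eq hY]
  exact jointTail_le_min s t

variable [IsProbabilityMeasure P] [IsProbabilityMeasure P']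

lemma integral_layer_mul_layer_sub (hX : IdentDistrib X X' P P') (hY : IdentDistrib Y Y' P P')
    (s t : ℝ) :
    ∫ ω, layer s (X' ω) * layer t (Y' ω) ∂P' - ∫ ω, layer s (X ω) * layer t (Y ω) ∂P =
      jointTail P' X' Y' s t - jointTail P X Y s t := by
  rw [integral_layer_mul_layer hX.aemeasurable_fst hY.aemeasurable_fst,
    integral_layer_mul_layer hX.aemeasurable_snd hY.aemeasurable_snd,
    measureReal_preimage_Ioi_eq hX, measureReal_preimage_Ioi_eq hY]
  ring

lemma integrable_jointTail_sub (hX : IdentDistrib X X' P P') (hY : IdentDistrib Y Y' P P')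
    (hXY : Integrable (fun ω => X ω * Y ω) P) (hXY' : Integrable (fun ω => X' ω * Y' ω) P') :
    Integrable fun q : ℝ × ℝ => jointTail P' X' Y' q.1 q.2 - jointTail P X Y q.1 q.2 := by
  simp only [← integral_layer_mul_layer_sub hX hY]
  exact (integrable_layer_mul_layer hX.aemeasurable_snd hY.aemeasurable_snd
    hXY').integral_prod_right.sub
      (integrable_layer_mul_layer hX.aemeasurable_fst hY.aemeasurable_fst hXY).integral_prod_right

/-- Hoeffding's formula, for the difference of two couplings of the same pair of laws. -/
lemma integral_jointTail_sub (hX : IdentDistrib X X' P P') (hY : IdentDistrib Y Y' P P')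
    (hXY : Integrable (fun ω => X ω * Y ω) P) (hXY' : Integrable (fun ω => X' ω * Y' ω) P') :
    ∫ q : ℝ × ℝ, (jointTail P' X' Y' q.1 q.2 - jointTail P X Y q.1 q.2) =
      ∫ ω, X' ω * Y' ω ∂P' - ∫ ω, X ω * Y ω ∂P := by
  simp only [← integral_layer_mul_layer_sub hX hY]
  rw [integral_mul_eq_integral_layer hX.aemeasurable_fst hY.aemeasurable_fst hXY,
    integral_mul_eq_integral_layer hX.aemeasurable_snd hY.aemeasurable_snd hXY']
  exact integral_sub (integrable_layer_mul_layer hX.aemeasurable_snd hY.aemeasurable_snd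
    hXY').integral_prod_right
      (integrable_layer_mul_layer hX.aemeasurable_fst hY.aemeasurable_fst hXY).integral_prod_right

lemma AEComonotone.integral_mul_le (h : AEComonotone P' X' Y') (hX : IdentDistrib X X' P P')
    (hY : IdentDistrib Y Y' P P') (hXY : Integrable (fun ω => X ω * Y ω) P)
    (hXY' : Integrable (fun ω => X' ω * Y' ω) P') :
    ∫ ω, X ω * Y ω ∂P ≤ ∫ ω, X' ω * Y' ω ∂P' := by
  rw [← sub_nonneg, ← integral_jointTail_sub hX hY hXY hXY']
  exact integral_nonneg fun q => sub_nonneg.2 (h.jointTail_le hX hY _ _)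

lemma tendsto_measureReal_Ioi (μ : Measure ℝ) [IsProbabilityMeasure μ] (s : ℝ) :
    Tendsto (fun r => μ.real (Set.Ioi r)) (𝓝[>] s) (𝓝 (μ.real (Set.Ioi s))) := by
  simp only [measureReal_Ioi_eq_one_sub_cdf]
  exact (((cdf μ).right_continuous s).mono Set.Ioi_subset_Ici_self).tendsto.const_sub 1

lemma tendsto_measureReal_preimage_Ioi (hX : AEMeasurable X P) (s : ℝ) :
    Tendsto (fun r => P.real (X ⁻¹' Set.Ioi r)) (𝓝[>] s) (𝓝 (P.real (X ⁻¹' Set.Ioi s))) := by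
  have := Measure.isProbabilityMeasure_map hX
  simpa only [map_measureReal_apply_of_aemeasurable hX measurableSet_Ioi] using
    tendsto_measureReal_Ioi (P.map X) s

lemma aeComonotone_of_ae_min_le_jointTail (hX : AEMeasurable X P) (hY : AEMeasurable Y P)
    (h : ∀ᵐ q : ℝ × ℝ, min (P.real (X ⁻¹' Set.Ioi q.1)) (P.real (Y ⁻¹' Set.Ioi q.2)) ≤
      jointTail P X Y q.1 q.2) : AEComonotone P X Y := by
  refine (aeComonotone_iff_min_le_jointTail hX hY).2 fun s t => ?_
  have hclosure : (s, t) ∈ closure (Set.Ioi s ×ˢ Set.Ioi t ∩ {q : ℝ × ℝ |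
      min (P.real (X ⁻¹' Set.Ioi q.1)) (P.real (Y ⁻¹' Set.Ioi q.2)) ≤
        jointTail P X Y q.1 q.2}) := by
    refine closure_minimal ((Measure.dense_of_ae h).open_subset_closure_inter
      (isOpen_Ioi.prod isOpen_Ioi)) isClosed_closure ?_
    rw [closure_prod_eq, closure_Ioi, closure_Ioi]
    exact ⟨Set.self_mem_Ici, Set.self_mem_Ici⟩
  have := mem_closure_iff_nhdsWithin_neBot.1 hclosure
  have hle : 𝓝[Set.Ioi s ×ˢ Set.Ioi t ∩ {q : ℝ × ℝ |
      min (P.real (X ⁻¹' Set.Ioi q.1)) (P.real (Y ⁻¹' Set.Ioi q.2)) ≤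
        jointTail P X Y q.1 q.2}] (s, t) ≤ 𝓝[>] s ×ˢ 𝓝[>] t :=
    (nhdsWithin_mono _ Set.inter_subset_left).trans_eq (nhdsWithin_prod_eq ..)
  refine le_of_tendsto ((((tendsto_measureReal_preimage_Ioi hX s).comp tendsto_fst).min
    ((tendsto_measureReal_preimage_Ioi hY t).comp tendsto_snd)).mono_left hle) ?_
  filter_upwards [self_mem_nhdsWithin] with q hq
  exact hq.2.trans (jointTail_mono (le_of_lt hq.1.1) (le_of_lt hq.1.2))

lemma AEComonotone.of_integral_mul_le (h : AEComonotone P' X' Y') (hX : IdentDistrib X X' P P')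
    (hY : IdentDistrib Y Y' P P') (hXY : Integrable (fun ω => X ω * Y ω) P)
    (hXY' : Integrable (fun ω => X' ω * Y' ω) P')
    (hle : ∫ ω, X' ω * Y' ω ∂P' ≤ ∫ ω, X ω * Y ω ∂P) : AEComonotone P X Y := by
  have hnonneg : ∀ q : ℝ × ℝ, 0 ≤ jointTail P' X' Y' q.1 q.2 - jointTail P X Y q.1 q.2 :=
    fun q => sub_nonneg.2 (h.jointTail_le hX hY _ _)
  have hzero : ∫ q : ℝ × ℝ, (jointTail P' X' Y' q.1 q.2 - jointTail P X Y q.1 q.2) = 0 :=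
    le_antisymm ((integral_jointTail_sub hX hY hXY hXY').trans_le (sub_nonpos.2 hle))
      (integral_nonneg hnonneg)
  refine aeComonotone_of_ae_min_le_jointTail hX.aemeasurable_fst hY.aemeasurable_fst ?_
  filter_upwards [(integral_eq_zero_iff_of_nonneg hnonneg
    (integrable_jointTail_sub hX hY hXY hXY')).1 hzero] with q hq
  rw [← sub_eq_zero.1 hq, h.jointTail_eq_min hX.aemeasurable_snd hY.aemeasurable_snd,
    ← measureReal_preimage_Ioi_eq hX, ← measureReal_preimage_Ioi_eq hY]

end Hoeffding

section Quantile

/-- The quantile function of a probability measure on `ℝ`. The level `u` is kept in the open unit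
interval, where the infimum is attained. -/
noncomputable def quantile (μ : Measure ℝ) (u : Set.Ioo (0 : ℝ) 1) : ℝ :=
  sInf {x | (u : ℝ) ≤ cdf μ x}

lemma quantile_le_iff (μ : Measure ℝ) (u : Set.Ioo (0 : ℝ) 1) (x : ℝ) :
    quantile μ u ≤ x ↔ (u : ℝ) ≤ cdf μ x := by
  have hbdd : BddBelow {x | (u : ℝ) ≤ cdf μ x} := by
    obtain ⟨y, hy⟩ := ((tendsto_cdf_atBot μ).eventually_lt_const u.2.1).exists
    exact ⟨y, fun z hz => le_of_not_gt fun h => (hz.trans (monotone_cdf μ h.le)).not_gt hy⟩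
  have hne : {x | (u : ℝ) ≤ cdf μ x}.Nonempty := by
    obtain ⟨y, hy⟩ := ((tendsto_cdf_atTop μ).eventually_const_lt u.2.2).exists
    exact ⟨y, hy.le⟩
  refine ⟨fun h => ?_, fun h => csInf_le hbdd h⟩
  have hlim : Tendsto (cdf μ) (𝓝[>] x) (𝓝 (cdf μ x)) :=
    (((cdf μ).right_continuous x).mono Set.Ioi_subset_Ici_self).tendsto
  refine ge_of_tendsto hlim ?_
  filter_upwards [self_mem_nhdsWithin] with y hy
  obtain ⟨z, hz, hzy⟩ := exists_lt_of_csInf_lt hne (lt_of_le_of_lt h hy)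
  exact hz.trans (monotone_cdf μ hzy.le)

lemma preimage_quantile_Iic (μ : Measure ℝ) (x : ℝ) :
    quantile μ ⁻¹' Set.Iic x = (↑) ⁻¹' Set.Iic (cdf μ x) :=
  Set.ext fun u => quantile_le_iff μ u x

lemma measurable_quantile (μ : Measure ℝ) : Measurable (quantile μ) := by
  refine measurable_of_Iic fun x => ?_
  rw [preimage_quantile_Iic]
  exact measurable_subtype_coe measurableSet_Iic

attribute [local instance] Measure.Subtype.measureSpace

instance isProbabilityMeasure_volume_Ioo :
    IsProbabilityMeasure (volume : Measure (Set.Ioo (0 : ℝ) 1)) where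
  measure_univ := by
    rw [← volume_image_subtype_coe measurableSet_Ioo, Set.image_univ, Subtype.range_coe,
      Real.volume_Ioo, sub_zero, ENNReal.ofReal_one]

lemma hasLaw_quantile (μ : Measure ℝ) [IsProbabilityMeasure μ] :
    HasLaw (quantile μ) μ (volume : Measure (Set.Ioo (0 : ℝ) 1)) := by
  have hm := measurable_quantile μ
  have := Measure.isProbabilityMeasure_map (μ := volume) hm.aemeasurable
  refine ⟨hm.aemeasurable, Measure.ext_of_Iic _ _ fun x => ?_⟩
  have hIoc : (Set.Ioo 0 1 ∩ Set.Iic (cdf μ x) : Set ℝ) =ᵐ[volume] Set.Ioc 0 (cdf μ x) := by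
    refine (Ioo_ae_eq_Ioc.inter .rfl).trans ?_
    rw [Set.Ioc_inter_Iic, min_eq_right (cdf_le_one μ x)]
    exact .rfl
  rw [Measure.map_apply hm measurableSet_Iic, preimage_quantile_Iic,
    ← volume_image_subtype_coe measurableSet_Ioo, Subtype.image_preimage_coe, measure_congr hIoc,
    Real.volume_Ioc, sub_zero, ofReal_cdf]

lemma aeComonotone_quantile (P : Measure (Set.Ioo (0 : ℝ) 1)) (μ ν : Measure ℝ) :
    AEComonotone P (quantile μ) (quantile ν) := by
  have hlt (μ : Measure ℝ) (s : ℝ) (u : Set.Ioo (0 : ℝ) 1) : s < quantile μ u ↔ cdf μ s < u := by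
    rw [← not_le, quantile_le_iff, not_le]
  intro s t
  rcases le_total (cdf ν t) (cdf μ s) with h | h
  · exact .inl (.of_forall fun u hu => (hlt ν t u).2 (h.trans_lt ((hlt μ s u).1 hu)))
  · exact .inr (.of_forall fun u hu => (hlt μ s u).2 (h.trans_lt ((hlt ν t u).1 hu)))

lemma AEComonotone.map {Ω Ω' : Type*} [MeasurableSpace Ω] [MeasurableSpace Ω'] {P : Measure Ω}
    {f : Ω → Ω'} {X Y : Ω' → ℝ} (h : AEComonotone P (X ∘ f) (Y ∘ f)) (hf : AEMeasurable f P)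
    (hX : Measurable X) (hY : Measurable Y) : AEComonotone (P.map f) X Y := by
  have hdesc {A B : Set Ω'} (hA : MeasurableSet A) (hB : MeasurableSet B)
      (hle : f ⁻¹' A ≤ᵐ[P] f ⁻¹' B) : A ≤ᵐ[P.map f] B := by
    rw [ae_le_set, Measure.map_apply_of_aemeasurable hf (hA.diff hB)]
    exact ae_le_set.1 hle
  exact fun s t => (h s t).imp (hdesc (hX measurableSet_Ioi) (hY measurableSet_Ioi))
    (hdesc (hY measurableSet_Ioi) (hX measurableSet_Ioi))

variable {ι : Type*}

/-- The comonotone coupling of the `μ i`: the joint law of their quantile functions at a common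
uniform level. -/
noncomputable def comonotoneCoupling (μ : ι → Measure ℝ) : Measure (ι → ℝ) :=
  (volume : Measure (Set.Ioo (0 : ℝ) 1)).map fun u i => quantile (μ i) u

lemma measurable_quantile_pi (μ : ι → Measure ℝ) : Measurable fun u i => quantile (μ i) u :=
  measurable_pi_lambda _ fun i => measurable_quantile (μ i)

instance isProbabilityMeasure_comonotoneCoupling (μ : ι → Measure ℝ) :
    IsProbabilityMeasure (comonotoneCoupling μ) :=
  Measure.isProbabilityMeasure_map (measurable_quantile_pi μ).aemeasurable

lemma hasLaw_comonotoneCoupling (μ : ι → Measure ℝ) [∀ i, IsProbabilityMeasure (μ i)] (i : ι) :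
    HasLaw (fun x => x i) (μ i) (comonotoneCoupling μ) :=
  ⟨(measurable_pi_apply i).aemeasurable,
    (Measure.map_map (measurable_pi_apply i) (measurable_quantile_pi μ)).trans
      (hasLaw_quantile (μ i)).map_eq⟩

lemma aeComonotone_comonotoneCoupling (μ : ι → Measure ℝ) (i j : ι) :
    AEComonotone (comonotoneCoupling μ) (fun x => x i) (fun x => x j) :=
  (aeComonotone_quantile volume (μ i) (μ j)).map (measurable_quantile_pi μ).aemeasurable
    (measurable_pi_apply i) (measurable_pi_apply j)

lemma measure_pi_Ioi_of_aeComonotone [Countable ι] {γ : Measure (ι → ℝ)} [IsFiniteMeasure γ]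
    (hγ : ∀ i j, AEComonotone γ (fun x => x i) (fun x => x j)) (s : ι → ℝ) {i : ι}
    (hi : ∀ j, γ.map (fun x => x i) (Set.Ioi (s i)) ≤ γ.map (fun x => x j) (Set.Ioi (s j))) :
    γ (Set.univ.pi fun j => Set.Ioi (s j)) = γ.map (fun x => x i) (Set.Ioi (s i)) := by
  have hmap j : γ.map (fun x => x j) (Set.Ioi (s j)) = γ ((fun x => x j) ⁻¹' Set.Ioi (s j)) :=
    Measure.map_apply (measurable_pi_apply j) measurableSet_Ioi
  have hle j : (fun x : ι → ℝ => x i) ⁻¹' Set.Ioi (s i) ≤ᵐ[γ] (fun x => x j) ⁻¹' Set.Ioi (s j) := by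
    refine (hγ i j (s i) (s j)).elim id fun h => ?_
    refine (ae_eq_of_ae_subset_of_measure_ge h ?_
      (measurable_pi_apply j measurableSet_Ioi).nullMeasurableSet (measure_ne_top _ _)).symm.le
    rw [← hmap, ← hmap]
    exact hi j
  rw [hmap]
  refine measure_congr ?_
  filter_upwards [ae_all_iff.2 hle] with x hx
  exact propext ⟨fun h => h i (Set.mem_univ i), fun h j _ => hx j h⟩

lemma eq_of_aeComonotone [Finite ι] [Nonempty ι] {γ γ' : Measure (ι → ℝ)}
    [IsProbabilityMeasure γ] [IsProbabilityMeasure γ']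
    (hγ : ∀ i j, AEComonotone γ (fun x => x i) (fun x => x j))
    (hγ' : ∀ i j, AEComonotone γ' (fun x => x i) (fun x => x j))
    (hmap : ∀ i, γ.map (fun x => x i) = γ'.map (fun x => x i)) : γ = γ' := by
  have hspan : IsCountablySpanning (Set.range (Set.Ioi : ℝ → Set ℝ)) := by
    refine ⟨fun n : ℕ => Set.Ioi (-n : ℝ), fun n => ⟨_, rfl⟩, Set.eq_univ_of_forall fun x => ?_⟩
    obtain ⟨n, hn⟩ := exists_nat_gt (-x)
    exact Set.mem_iUnion.2 ⟨n, neg_lt.1 hn⟩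
  have hgen (i : ι) : MeasurableSpace.generateFrom (Set.range (Set.Ioi : ℝ → Set ℝ)) =
      (inferInstance : MeasurableSpace ((fun _ : ι => ℝ) i)) := by
    rw [← borel_eq_generateFrom_Ioi, ← BorelSpace.measurable_eq]
  refine ext_of_generate_finite _ (generateFrom_eq_pi hgen fun _ => hspan).symm
    (IsPiSystem.pi fun _ => isPiSystem_Ioi) ?_ (by rw [measure_univ, measure_univ])
  rintro _ ⟨S, hS, rfl⟩
  choose s hs using fun i => hS i (Set.mem_univ i)
  obtain rfl : (fun i => Set.Ioi (s i)) = S := funext hs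
  obtain ⟨i, hi⟩ := Finite.exists_min fun i => γ.map (fun x => x i) (Set.Ioi (s i))
  rw [measure_pi_Ioi_of_aeComonotone hγ s hi,
    measure_pi_Ioi_of_aeComonotone hγ' s (by simpa only [hmap] using hi), hmap]

end Quantile

section Uniqueness

variable {d : ℕ} {c : Fin d → Fin d → ℝ} {μ : Fin d → Measure ℝ} {γ γ' : Measure (Fin d → ℝ)}

lemma isTransport_comonotoneCoupling [∀ i, IsProbabilityMeasure (μ i)]
    (hμ : ∀ i, Integrable (fun x : ℝ => x) (μ i)) : IsTransport μ (comonotoneCoupling μ) where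
  prob := inferInstance
  integrable := Integrable.of_eval fun i => memLp_one_iff_integrable.1 <|
    memLp_of_hasLaw (hasLaw_comonotoneCoupling μ i) (memLp_one_iff_integrable.2 (hμ i))
  marginal i := (hasLaw_comonotoneCoupling μ i).map_eq

lemma IsTransport.integrable_mul (h : IsTransport μ γ)
    (hμ : ∀ i, MemLp (fun x : ℝ => x) 2 (μ i)) (i j : Fin d) :
    Integrable (fun x => x i * x j) γ :=
  (memLp_of_hasLaw (h.hasLaw i) (hμ i)).integrable_mul (memLp_of_hasLaw (h.hasLaw j) (hμ j))

lemma IsTransport.integral_mul_le_of_aeComonotone (h : IsTransport μ γ) (h' : IsTransport μ γ')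
    (hμ : ∀ i, MemLp (fun x : ℝ => x) 2 (μ i)) {i j : Fin d}
    (hco : AEComonotone γ' (fun x => x i) (fun x => x j)) :
    ∫ x, x i * x j ∂γ ≤ ∫ x, x i * x j ∂γ' :=
  have := h.prob
  have := h'.prob
  hco.integral_mul_le ((h.hasLaw i).identDistrib (h'.hasLaw i))
    ((h.hasLaw j).identDistrib (h'.hasLaw j)) (h.integrable_mul hμ i j) (h'.integrable_mul hμ i j)

lemma IsOptimalTransport.integral_mul_eq_of_pos (h : IsOptimalTransport c μ γ)
    (h' : IsTransport μ γ') (hc : ∀ i j, i < j → 0 ≤ c i j)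
    (hμ : ∀ i, MemLp (fun x : ℝ => x) 2 (μ i))
    (hmul : ∀ i j, ∫ x, x i * x j ∂γ ≤ ∫ x, x i * x j ∂γ') {i j : Fin d} (hij : i < j)
    (hcij : 0 < c i j) : ∫ x, x i * x j ∂γ = ∫ x, x i * x j ∂γ' := by
  have hcost := h.2 γ' h'
  rw [integral_cost c fun i => memLp_of_hasLaw (h'.hasLaw i) (hμ i),
    integral_cost c fun i => memLp_of_hasLaw (h.1.hasLaw i) (hμ i)] at hcost
  have hterm k : ∀ l ∈ Finset.Ioi k, c k l * ∫ x, x k * x l ∂γ ≤ c k l * ∫ x, x k * x l ∂γ' :=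
    fun l hl => mul_le_mul_of_nonneg_left (hmul k l) (hc k l (Finset.mem_Ioi.1 hl))
  have hrow k (_ : k ∈ Finset.univ) := Finset.sum_le_sum (hterm k)
  have hrow_eq := (Finset.sum_eq_sum_iff_of_le hrow).1
    ((Finset.sum_le_sum hrow).antisymm hcost) i (Finset.mem_univ i)
  exact mul_left_cancel₀ hcij.ne'
    ((Finset.sum_eq_sum_iff_of_le (hterm i)).1 hrow_eq j (Finset.mem_Ioi.2 hij))

variable [∀ i, IsProbabilityMeasure (μ i)]

lemma IsOptimalTransport.aeComonotone_of_pos (h : IsOptimalTransport c μ γ)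
    (hc : ∀ i j, i < j → 0 ≤ c i j) (hμ : ∀ i, MemLp (fun x : ℝ => x) 2 (μ i)) {i j : Fin d}
    (hij : i < j) (hcij : 0 < c i j) : AEComonotone γ (fun x => x i) (fun x => x j) := by
  have := h.1.prob
  have hco := aeComonotone_comonotoneCoupling μ
  have hT : IsTransport μ (comonotoneCoupling μ) :=
    isTransport_comonotoneCoupling fun i => (hμ i).integrable one_le_two
  have heq := h.integral_mul_eq_of_pos hT hc hμ
    (fun k l => h.1.integral_mul_le_of_aeComonotone hT hμ (hco k l)) hij hcij
  exact (hco i j).of_integral_mul_le ((h.1.hasLaw i).identDistrib (hT.hasLaw i))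
    ((h.1.hasLaw j).identDistrib (hT.hasLaw j)) (h.1.integrable_mul hμ i j)
    (hT.integrable_mul hμ i j) heq.ge

lemma IsOptimalTransport.aeComonotone (h : IsOptimalTransport c μ γ)
    (hc : ∀ i j, i < j → 0 ≤ c i j) (hconn : (costGraph c).Connected)
    (hμ : ∀ i, MemLp (fun x : ℝ => x) 2 (μ i)) [∀ i, NullSingletonClass (μ i)] (i j : Fin d) :
    AEComonotone γ (fun x => x i) (fun x => x j) := by
  have := h.1.prob
  have hatom j : NullSingletonClass (γ.map fun x => x j) := (h.1.marginal j).symm ▸ inferInstance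
  have hequiv : Equivalence fun i j => AEComonotone γ (fun x => x i) (fun x => x j) :=
    { refl := fun i => .refl _
      symm := .symm
      trans := fun h₁ h₂ => h₁.trans h₂ (measurable_pi_apply _).aemeasurable
        (measurable_pi_apply _).aemeasurable }
  exact rel_of_costGraph_connected hconn hequiv (fun _ _ => h.aeComonotone_of_pos hc hμ) i j

lemma IsOptimalTransport.eq_comonotoneCoupling (h : IsOptimalTransport c μ γ)
    (hc : ∀ i j, i < j → 0 ≤ c i j) (hconn : (costGraph c).Connected)
    (hμ : ∀ i, MemLp (fun x : ℝ => x) 2 (μ i)) [∀ i, NullSingletonClass (μ i)] :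
    γ = comonotoneCoupling μ :=
  have := hconn.nonempty
  have := h.1.prob
  eq_of_aeComonotone (h.aeComonotone hc hconn hμ) (aeComonotone_comonotoneCoupling μ) fun i =>
    (h.1.marginal i).trans (hasLaw_comonotoneCoupling μ i).map_eq.symm

end Uniqueness

end CovMMOT

theorem theorem5p3_general {d : ℕ} (c : Fin d → Fin d → ℝ) (hc : ∀ i j, i < j → 0 ≤ c i j)
    (hconn : (CovMMOT.costGraph c).Connected)
    (μ ν : Fin d → Measure ℝ) [∀ i, IsProbabilityMeasure (μ i)]
    (hμ : ∀ i, MemLp (fun x : ℝ => x) 2 (μ i)) (hν : ∀ i, MemLp (fun x : ℝ => x) 2 (ν i))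
    (a : Fin d → ℝ) (hLIM : CovMMOT.LIM μ ν a)
    (π : Measure ((Fin d → ℝ) × (Fin d → ℝ))) (hπ : CovMMOT.IsMMOT c μ ν π) :
    (∀ K : Kernel (Fin d → ℝ) (Fin d → ℝ), IsMarkovKernel K → π = π.fst.compProd K →
      ∀ᵐ x ∂π.fst, (K x).support ⊆ {y | y - x ∈ Submodule.span ℝ {a}}) ∧
    CovMMOT.IsOptimalTransport c μ π.fst ∧
    ((∀ i x, μ i {x} = 0) → π.fst = CovMMOT.comonotoneCoupling μ) := by
  have hopt := hπ.isOptimalTransport_fst hc hμ hν hLIM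
  refine ⟨fun K _ hK => hπ.support_subset hc hconn hμ hν hLIM K hK, hopt, fun hatom => ?_⟩
  have : ∀ i, NullSingletonClass (μ i) := fun i => ⟨hatom i⟩
  exact hopt.eq_comonotoneCoupling hc hconn hμ

theorem theorem5p3 {d : ℕ} (c : Fin d → Fin d → ℝ) (hc : ∀ i j, i < j → 0 ≤ c i j)
    (hconn : (CovMMOT.costGraph c).Connected)
    (μ ν : Fin d → Measure ℝ)
    [∀ i, IsProbabilityMeasure (μ i)] [∀ i, IsProbabilityMeasure (ν i)]
    (hμ : ∀ i, MemLp (fun x : ℝ => x) 2 (μ i)) (hν : ∀ i, MemLp (fun x : ℝ => x) 2 (ν i))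
    (a : Fin d → ℝ) (hLIM : CovMMOT.LIM μ ν a) :
    (∀ π : Measure ((Fin d → ℝ) × (Fin d → ℝ)), CovMMOT.IsMMOT c μ ν π →
      (∀ K : Kernel (Fin d → ℝ) (Fin d → ℝ), IsMarkovKernel K → π = π.fst.compProd K →
        ∀ᵐ x ∂π.fst, (K x).support ⊆ {y | y - x ∈ Submodule.span ℝ {a}}) ∧
      CovMMOT.IsOptimalTransport c μ π.fst) ∧
    ((d = 2 ∨ d = 3) → (∀ i x, μ i {x} = 0) →
      ∀ π π' : Measure ((Fin d → ℝ) × (Fin d → ℝ)),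
        CovMMOT.IsMMOT c μ ν π → CovMMOT.IsMMOT c μ ν π' → π.fst = π'.fst) := by
  have hgen := theorem5p3_general c hc hconn μ ν hμ hν a hLIM
  exact ⟨fun π hπ => ⟨(hgen π hπ).1, (hgen π hπ).2.1⟩, fun _ hatom π π' hπ hπ' =>
    ((hgen π hπ).2.2 hatom).trans ((hgen π' hπ').2.2 hatom).symm⟩
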